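/- Let $n\ge 0$ and let $P$ be an $n\times n$ matrix of rational functions of $s$ with complex (in particular, possibly real) coefficients such that $\det(I+P)$ is not identically zero. Call a point of $\mathbb{C}$ unstable if it lies in the closed right half plane $\{\operatorname{Re} s\ge 0\}$. A Smith–McMillan form of $P$ is a diagonal matrix $\operatorname{diag}(\varepsilon_1/\psi_1,\dots,\varepsilon_n/\psi_n)$ such that $P=U\operatorname{diag}(\varepsilon_i/\psi_i)V$ with $U,V$ unimodular polynomial matrices, where the $\psi_i$ are monic polynomials, each polynomial $\varepsilon_i$ is monic or $0$, $\varepsilon_i$ and $\psi_i$ are coprime, $\varepsilon_i\mid\varepsilon_{i+1}$ and $\psi_{i+1}\mid\psi_i$. Such a form exists, and for it the following holds: the number of unstable poles of $P$, counted with Smith–McMillan multiplicities, is the number of unstable roots of $\psi_1\cdots\psi_n$ counted with multiplicity, and the unity-feedback closed loop $P(I+P)^{-1}=I-(I+P)^{-1}$ is stable, i.e. all (finite) poles of all its entries lie in the open left half plane, if and only if both 1. $\det(I+P)$ has no zeros in the closed right half plane; and 2. the number of unstable poles of the rational function $\det(I+P)$, counted with multiplicity, equals the number of unstable poles of $P$,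 counted with Smith–McMillan multiplicities. Zeros and poles of a scalar rational function are the roots of its numerator and denominator in lowest terms. -/

import Mathlib

open scoped Polynomial

namespace Feedback

/-- The point `z` is unstable: it lies in the closed right half plane. -/
def Unstable (z : ℂ) : Prop := 0 ≤ z.re

/-- `z` is a zero of the rational function `f`: a root of the numerator of `f`
in lowest terms. -/
def IsZero (f : RatFunc ℂ) (z : ℂ) : Prop := f.num.IsRoot z

/-- `z` is a pole of the rational function `f`: a root of the denominator of `f`
in lowest terms. -/
def IsPole (f : RatFunc ℂ) (z : ℂ) : Prop := f.denom.IsRoot z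

/-- A square rational transfer matrix is stable if all poles of all its entries lie in the
open left half plane. -/
def IsStable {n : ℕ} (G : Matrix (Fin n) (Fin n) (RatFunc ℂ)) : Prop :=
  ∀ i j z, IsPole (G i j) z → z.re < 0

/-- The closed loop `P (I + P)⁻¹` of the unity negative feedback interconnection. -/
noncomputable def closedLoop {n : ℕ} (P : Matrix (Fin n) (Fin n) (RatFunc ℂ)) :
    Matrix (Fin n) (Fin n) (RatFunc ℂ) :=
  P * (1 + P)⁻¹

open Classical in
/-- The number of roots of `p` in the closed right half plane, counted with multiplicity. -/
noncomputable def unstableRootCount (p : ℂ[X]) : ℕ := p.roots.countP Unstable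

/-- The number of unstable poles of a scalar rational function, counted with multiplicity. -/
noncomputable def unstablePoleCount (f : RatFunc ℂ) : ℕ := unstableRootCount f.denom

/-- `diag (ε₀/ψ₀, …, ε₍ₙ₋₁₎/ψ₍ₙ₋₁₎)` is the Smith–McMillan form of `P`.
By `num_dvd` the vanishing `ε i` come last, and for these `coprime` and `den_monic` give
`ψ i = 1`; so the form is `diag (ε₀/ψ₀, …, ε₍ᵣ₋₁₎/ψ₍ᵣ₋₁₎, 0, …, 0)`, `r` the normal rank. -/
structure IsSmithMcMillanForm {n : ℕ} (P : Matrix (Fin n) (Fin n) (RatFunc ℂ))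
    (ε ψ : Fin n → ℂ[X]) : Prop where
  den_monic : ∀ i, (ψ i).Monic
  num_monic : ∀ i, ε i = 0 ∨ (ε i).Monic
  coprime : ∀ i, IsCoprime (ε i) (ψ i)
  num_dvd : ∀ i j, i ≤ j → ε i ∣ ε j
  den_dvd : ∀ i j, i ≤ j → ψ j ∣ ψ i
  /-- `P` is equivalent to the diagonal matrix by unimodular polynomial matrices. -/
  equiv : ∃ U V : Matrix (Fin n) (Fin n) ℂ[X], IsUnit U.det ∧ IsUnit V.det ∧
    P = U.map (algebraMap ℂ[X] (RatFunc ℂ)) *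
      Matrix.diagonal (fun i => algebraMap ℂ[X] (RatFunc ℂ) (ε i) /
        algebraMap ℂ[X] (RatFunc ℂ) (ψ i)) *
      V.map (algebraMap ℂ[X] (RatFunc ℂ))

end Feedback

/-!
A Smith–McMillan form `P = U diag (ε / ψ) V` yields the right coprime polynomial factorization
`P = N M⁻¹` with `N = U diag ε` and `M = V⁻¹ diag ψ`: the scalar Bézout identities for `ε i`, `ψ i`
combine to `X N + Y M = 1` (`IsSmithMcMillanForm.exists_coprime_factorization`). The closed loop is
`N (M + N)⁻¹`, and by the Bézout identity it is stable exactly when `(M + N)⁻¹` is, that is, when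
`det (M + N)` has no unstable roots (`isStable_closedLoop_iff`).

On the other hand `det (1 + P) = det (M + N) / det M`, and `det M` is `∏ i, ψ i` up to a unit. The
zeros and poles of `det (1 + P)` are what remains of the roots of `det (M + N)` and of `∏ i, ψ i`
after cancellation. Counting unstable roots in the reduced and in the unreduced fraction, one sees
that `det (M + N)` has no unstable root if and only if no unstable zero remains and no unstable
root of `∏ i, ψ i` is cancelled (`forall_unstable_not_isRoot_iff`).

The Smith–McMillan form exists by the Smith normal form with divisibility chain over a Euclidean
domain (`exists_smith_form`), applied to `P` times a common denominator. The Smith form is proved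
by choosing, among all equivalent matrices, one whose corner entry is nonzero and minimal in the
Euclidean order; such a corner divides every entry (`IsMinimalPivot.dvd_apply`), so that it splits
off and the rest of the matrix is a multiple of it.
-/

namespace Feedback

open Matrix

/-! ### Equivalence of matrices and the Smith form -/

/-- Two square matrices over a ring are equivalent if one arises from the other by multiplying
by invertible matrices on both sides. -/
def Equivalent {m R : Type*} [Fintype m] [DecidableEq m] [CommRing R] (A B : Matrix m m R) : Prop :=
  ∃ U V : Matrix m m R, IsUnit U ∧ IsUnit V ∧ B = U * A * V

namespace Equivalent

variable {m k R : Type*} [Fintype m] [DecidableEq m] [Fintype k] [DecidableEq k] [CommRing R]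
  {A B C : Matrix m m R}

theorem refl (A : Matrix m m R) : Equivalent A A :=
  ⟨1, 1, isUnit_one, isUnit_one, by simp⟩

theorem trans (h : Equivalent A B) (h' : Equivalent B C) : Equivalent A C := by
  obtain ⟨U, V, hU, hV, rfl⟩ := h
  obtain ⟨U', V', hU', hV', rfl⟩ := h'
  exact ⟨U' * U, V * V', hU'.mul hU, hV.mul hV', by simp only [Matrix.mul_assoc]⟩

theorem symm (h : Equivalent A B) : Equivalent B A := by
  obtain ⟨U, V, hU, hV, rfl⟩ := h
  refine ⟨U⁻¹, V⁻¹, isUnit_nonsing_inv_iff.2 hU, isUnit_nonsing_inv_iff.2 hV, ?_⟩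
  rw [isUnit_iff_isUnit_det] at hU hV
  rw [Matrix.mul_assoc, Matrix.mul_assoc, mul_nonsing_inv _ hV, Matrix.mul_one, ← Matrix.mul_assoc,
    nonsing_inv_mul _ hU, Matrix.one_mul]

theorem mul_right (A : Matrix m m R) {V : Matrix m m R} (hV : IsUnit V) : Equivalent A (A * V) :=
  ⟨1, V, isUnit_one, hV, by simp⟩

theorem mul_left (A : Matrix m m R) {U : Matrix m m R} (hU : IsUnit U) : Equivalent A (U * A) :=
  ⟨U, 1, hU, isUnit_one, by simp⟩

theorem transpose (h : Equivalent A B) : Equivalent Aᵀ Bᵀ := by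
  obtain ⟨U, V, hU, hV, rfl⟩ := h
  exact ⟨Vᵀ, Uᵀ, (isUnit_transpose V).2 hV, (isUnit_transpose U).2 hU, by
    simp [Matrix.transpose_mul, Matrix.mul_assoc]⟩

theorem submatrix (h : Equivalent A B) (e : k ≃ m) :
    Equivalent (A.submatrix e e) (B.submatrix e e) := by
  obtain ⟨U, V, hU, hV, rfl⟩ := h
  exact ⟨U.submatrix e e, V.submatrix e e, (isUnit_submatrix_equiv ..).2 hU,
    (isUnit_submatrix_equiv ..).2 hV, by simp only [submatrix_mul_equiv]⟩

/-- Equivalence of a scaled lower right block extends to the whole block diagonal matrix. -/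
theorem fromBlocks_smul (a : Matrix k k R) (p : R) (h : Equivalent A B) :
    Equivalent (fromBlocks a 0 0 (p • A)) (fromBlocks a 0 0 (p • B)) := by
  obtain ⟨U, V, hU, hV, rfl⟩ := h
  refine ⟨fromBlocks 1 0 0 U, fromBlocks 1 0 0 V, isUnit_fromBlocks_zero₂₁.2 ⟨isUnit_one, hU⟩,
    isUnit_fromBlocks_zero₂₁.2 ⟨isUnit_one, hV⟩, ?_⟩
  simp [fromBlocks_multiply]

theorem add_smul_col (A : Matrix m m R) {i j : m} (hij : i ≠ j) (c : R) :
    Equivalent A (A * transvection i j c) :=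
  mul_right A ((isUnit_iff_isUnit_det _).2 (by simp [det_transvection_of_ne _ _ hij]))

theorem swap_col (A : Matrix m m R) (i j : m) :
    Equivalent A (A * swap R i j) :=
  mul_right A ⟨GeneralLinearGroup.swap R i j, rfl⟩

end Equivalent

/-- `B` has a nonzero pivot at `(i, i)`, and no matrix equivalent to `B` has a nonzero entry at
`(i, i)` preceding it in the Euclidean order. -/
def IsMinimalPivot {m R : Type*} [Fintype m] [DecidableEq m] [EuclideanDomain R] (i : m)
    (B : Matrix m m R) : Prop :=
  B i i ≠ 0 ∧ ∀ C, Equivalent B C → C i i ≠ 0 → ¬ EuclideanDomain.r (C i i) (B i i)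

section Smith

variable {m R : Type*} [Fintype m] [DecidableEq m] [EuclideanDomain R]

theorem exists_isMinimalPivot (i : m) {A : Matrix m m R} (hA : A ≠ 0) :
    ∃ B, Equivalent A B ∧ IsMinimalPivot i B := by
  have hne : ∃ B, Equivalent A B ∧ B i i ≠ 0 := by
    obtain ⟨a, b, hab⟩ : ∃ a b, A a b ≠ 0 := by
      by_contra! h
      exact hA (Matrix.ext h)
    refine ⟨swap R i a * A * swap R b i, ⟨_, _, ⟨GeneralLinearGroup.swap R i a, rfl⟩,
      ⟨GeneralLinearGroup.swap R b i, rfl⟩, rfl⟩, ?_⟩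
    rwa [mul_swap_apply_right, swap_mul_apply_left]
  obtain ⟨B, ⟨hAB, hB⟩, hmin⟩ := (InvImage.wf (fun B : Matrix m m R => B i i)
    EuclideanDomain.r_wellFounded).has_min {B | Equivalent A B ∧ B i i ≠ 0} hne
  exact ⟨B, hAB, hB, fun C hC hC0 => hmin C ⟨hAB.trans hC, hC0⟩⟩

namespace IsMinimalPivot

variable {i : m} {B C : Matrix m m R}

theorem transpose (h : IsMinimalPivot i B) : IsMinimalPivot i Bᵀ :=
  ⟨h.1, fun C hC => h.2 Cᵀ (by simpa using hC.transpose)⟩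

theorem of_equivalent (h : IsMinimalPivot i B) (hBC : Equivalent B C) (he : C i i = B i i) :
    IsMinimalPivot i C :=
  ⟨he ▸ h.1, fun D hD hD0 => he ▸ h.2 D (hBC.trans hD) hD0⟩

/-- A minimal pivot divides its row: otherwise a division step produces a smaller pivot. -/
theorem dvd_row (h : IsMinimalPivot i B) (j : m) : B i i ∣ B i j := by
  obtain rfl | hij := eq_or_ne i j
  · exact dvd_rfl
  rw [← EuclideanDomain.mod_eq_zero]
  by_contra hr
  have he : (B * transvection i j (-(B i j / B i i)) * swap R j i) i i = B i j % B i i := by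
    rw [mul_swap_apply_right, mul_transvection_apply_same, EuclideanDomain.mod_eq_sub_mul_div]
    ring
  refine h.2 (B * transvection i j (-(B i j / B i i)) * swap R j i)
    ((Equivalent.add_smul_col B hij _).trans (Equivalent.swap_col _ j i)) ?_ ?_
  · rwa [he]
  · rw [he]
    exact EuclideanDomain.remainder_lt _ h.1

theorem dvd_col (h : IsMinimalPivot i B) (j : m) : B i i ∣ B j i :=
  h.transpose.dvd_row j

/-- A minimal pivot divides every entry: row operations that keep the pivot bring the entry into
the pivot's row, up to a multiple of the pivot. -/
theorem dvd_apply (h : IsMinimalPivot i B) (a b : m) : B i i ∣ B a b := by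
  obtain rfl | hia := eq_or_ne i a
  · exact h.dvd_row b
  obtain ⟨c, hc⟩ := h.dvd_col a
  -- Row `a` plus `(1 - c)` times row `i` has the pivot itself in column `i`.
  have hC : Equivalent B (swap R i a * (transvection a i (1 - c) * B)) :=
    (Equivalent.mul_left B ((isUnit_iff_isUnit_det _).2
      (by simp [det_transvection_of_ne _ _ hia.symm]))).trans
      (Equivalent.mul_left _ ⟨GeneralLinearGroup.swap R i a, rfl⟩)
  have hCrow (l : m) : (swap R i a * (transvection a i (1 - c) * B)) i l
      = B a l + (1 - c) * B i l := by
    rw [swap_mul_apply_left, transvection_mul_apply_same]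
  have hpivot : (swap R i a * (transvection a i (1 - c) * B)) i i = B i i := by
    rw [hCrow, hc]; ring
  have hdvd := (h.of_equivalent hC hpivot).dvd_row b
  rw [hpivot, hCrow] at hdvd
  exact (dvd_add_left ((h.dvd_row b).mul_left _)).1 hdvd

end IsMinimalPivot

/-- One step of the Smith reduction: a divisor `p` of all entries is split off as a corner, and
remains a factor of the complementary block. -/
theorem exists_equivalent_fromBlocks (A : Matrix (Unit ⊕ m) (Unit ⊕ m) R) :
    ∃ (p : R) (D : Matrix m m R),
      Equivalent A (fromBlocks (diagonal fun _ => p) 0 0 (p • D)) := by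
  obtain rfl | hA := eq_or_ne A 0
  · exact ⟨0, 0, by simpa [← diagonal_zero] using Equivalent.refl _⟩
  obtain ⟨B, hAB, hB⟩ := exists_isMinimalPivot (Sum.inl ()) hA
  choose E hE using hB.dvd_apply
  set p := B (Sum.inl ()) (Sum.inl ())
  let b : Matrix Unit m R := .of fun x y => E (Sum.inl x) (Sum.inr y)
  let c : Matrix m Unit R := .of fun x y => E (Sum.inr x) (Sum.inl y)
  let d : Matrix m m R := .of fun x y => E (Sum.inr x) (Sum.inr y)
  have hBE : B = fromBlocks (p • 1) (p • b) (p • c) (p • d) := by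
    ext (x | x) (y | y)
    · simp [p]
    all_goals simp [hE, b, c, d]
  refine ⟨p, d - c * b, hAB.trans ⟨fromBlocks 1 0 (-c) 1, fromBlocks 1 (-b) 0 1,
    isUnit_fromBlocks_zero₁₂.2 ⟨isUnit_one, isUnit_one⟩,
    isUnit_fromBlocks_zero₂₁.2 ⟨isUnit_one, isUnit_one⟩, ?_⟩⟩
  rw [hBE, ← smul_one_eq_diagonal]
  simp [fromBlocks_multiply, sub_eq_add_neg, add_comm]

/-- **Smith normal form** of a square matrix over a Euclidean domain, with the divisibility
chain of the diagonal entries. -/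
theorem exists_smith_form {n : ℕ} (A : Matrix (Fin n) (Fin n) R) :
    ∃ d : Fin n → R, (∀ i j, i ≤ j → d i ∣ d j) ∧ Equivalent A (diagonal d) := by
  induction n with
  | zero => exact ⟨0, fun i => i.elim0, Subsingleton.elim A _ ▸ Equivalent.refl _⟩
  | succ n ih =>
    let e : Fin (n + 1) ≃ Unit ⊕ Fin n :=
      (finSuccEquiv n).trans ((Equiv.optionEquivSumPUnit _).trans (Equiv.sumComm _ _))
    obtain ⟨p, D, hD⟩ := exists_equivalent_fromBlocks (A.submatrix e.symm e.symm)
    obtain ⟨d, hd, hDd⟩ := ih D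
    refine ⟨Fin.cons p fun i => p * d i, ?_, ?_⟩
    · intro i j hij
      induction i using Fin.cases with
      | zero =>
        induction j using Fin.cases with
        | zero => exact dvd_rfl
        | succ j => exact dvd_mul_right _ _
      | succ i =>
        induction j using Fin.cases with
        | zero => simp at hij
        | succ j => exact mul_dvd_mul_left p (hd i j (Fin.succ_le_succ_iff.1 hij))
    · have h := (hD.trans (hDd.fromBlocks_smul _ p)).submatrix e
      rw [submatrix_submatrix, Equiv.symm_comp_self, submatrix_id_id, ← diagonal_smul,
        fromBlocks_diagonal, submatrix_diagonal_equiv] at h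
      convert h using 2
      ext i
      induction i using Fin.cases with
      | zero => simp [e]
      | succ i => simp [e]

end Smith

/-! ### Existence of the Smith–McMillan form -/

/-- In a chain of fractions in lowest terms, each dividing the next, the numerators divide each
other upwards and the denominators downwards. -/
theorem dvd_and_dvd_of_mul_eq {R : Type*} [CommRing R] {a b a' b' q : R} (h : IsCoprime a b)
    (h' : IsCoprime a' b') (he : a' * b = q * a * b') : a ∣ a' ∧ b' ∣ b :=
  ⟨h.dvd_of_dvd_mul_right (he ▸ (dvd_mul_left a q).mul_right b'),
    h'.symm.dvd_of_dvd_mul_left (he ▸ dvd_mul_left b' _)⟩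

/-- The Smith–McMillan form is read off from the Smith form of the polynomial matrix obtained by
clearing denominators. -/
theorem exists_isSmithMcMillanForm {n : ℕ} (P : Matrix (Fin n) (Fin n) (RatFunc ℂ)) :
    ∃ ε ψ : Fin n → ℂ[X], IsSmithMcMillanForm P ε ψ := by
  set c := algebraMap ℂ[X] (RatFunc ℂ) with hc
  obtain ⟨⟨d, hd⟩, hdP⟩ := IsLocalization.exist_integer_multiples_of_finite
    (nonZeroDivisors ℂ[X]) (fun ij : Fin n × Fin n => P ij.1 ij.2)
  have hd0 : c d ≠ 0 := RatFunc.algebraMap_ne_zero (nonZeroDivisors.ne_zero hd)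
  choose a ha using hdP
  let A : Matrix (Fin n) (Fin n) ℂ[X] := .of fun i j => a (i, j)
  have hA : P = (c d)⁻¹ • A.map c := by
    ext i j
    have h := ha (i, j)
    simp only [Algebra.smul_def, ← hc] at h
    simp [A, h, hd0]
  obtain ⟨s, hs, hAs⟩ := exists_smith_form A
  obtain ⟨U, V, hU, hV, hUV⟩ := hAs.symm
  let x (i : Fin n) : RatFunc ℂ := c (s i) / c d
  have hchain (i j : Fin n) (hij : i ≤ j) :
      normalize (x i).num ∣ normalize (x j).num ∧ (x j).denom ∣ (x i).denom := by
    obtain ⟨q, hq⟩ := hs i j hij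
    rw [dvd_normalize_iff, normalize_dvd_iff]
    refine dvd_and_dvd_of_mul_eq (q := q) (x i).isCoprime_num_denom (x j).isCoprime_num_denom ?_
    rw [RatFunc.num_mul_eq_mul_denom_iff (x i).denom_ne_zero, map_mul, mul_div_assoc,
      RatFunc.num_div_denom]
    simp only [x, hq, ← hc, map_mul]
    ring
  -- The units that make the numerators monic move into the right unimodular factor.
  let w (i : Fin n) : ℂ[X]ˣ := (normUnit (x i).num)⁻¹
  have hw (i : Fin n) : x i = c (normalize (x i).num) / c (x i).denom * c (w i) := by
    rw [div_mul_eq_mul_div, ← map_mul, normalize_apply, mul_assoc, Units.mul_inv, mul_one,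
      RatFunc.num_div_denom]
  refine ⟨fun i => normalize (x i).num, fun i => (x i).denom, fun i => (x i).monic_denom,
    fun i => ?_, fun i => ?_, fun i j hij => (hchain i j hij).1, fun i j hij => (hchain i j hij).2,
    U, diagonal (fun i => (w i : ℂ[X])) * V, (isUnit_iff_isUnit_det _).1 hU, ?_, ?_⟩
  · exact or_iff_not_imp_left.2 fun h => Polynomial.monic_normalize (normalize_eq_zero.not.1 h)
  · exact (x i).isCoprime_num_denom.of_isCoprime_of_dvd_left (normalize_dvd_iff.2 dvd_rfl)
  · rw [det_mul, det_diagonal]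
    exact (IsUnit.prod_univ_iff.2 fun i => (w i).isUnit).mul ((isUnit_iff_isUnit_det _).1 hV)
  · have hdiag : (c d)⁻¹ • (diagonal s).map c
        = diagonal (fun i => c (normalize (x i).num) / c (x i).denom)
          * (diagonal fun i => (w i : ℂ[X])).map c := by
      rw [diagonal_map (map_zero c), diagonal_map (map_zero c), diagonal_mul_diagonal,
        ← diagonal_smul]
      congr 1
      ext1 i
      rw [← hw]
      simp [x, div_eq_inv_mul]
    rw [Matrix.map_mul, ← Matrix.mul_assoc, Matrix.mul_assoc (U.map c), ← hdiag, hA, hUV,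
      Matrix.map_mul, Matrix.map_mul]
    simp [← hc]

/-! ### Counting unstable roots -/

theorem unstableRootCount_mul {p q : ℂ[X]} (hp : p ≠ 0) (hq : q ≠ 0) :
    unstableRootCount (p * q) = unstableRootCount p + unstableRootCount q := by
  rw [unstableRootCount, Polynomial.roots_mul (mul_ne_zero hp hq), Multiset.countP_add]
  rfl

theorem unstableRootCount_prod {ι : Type*} (s : Finset ι) (p : ι → ℂ[X])
    (hp : ∀ i ∈ s, p i ≠ 0) :
    unstableRootCount (∏ i ∈ s, p i) = ∑ i ∈ s, unstableRootCount (p i) := by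
  classical
  induction s using Finset.induction_on with
  | empty => simp [unstableRootCount]
  | insert i s hi ih =>
    rw [Finset.forall_mem_insert] at hp
    rw [Finset.prod_insert hi, Finset.sum_insert hi,
      unstableRootCount_mul hp.1 (Finset.prod_ne_zero_iff.2 hp.2), ih hp.2]

theorem unstableRootCount_of_isUnit {p : ℂ[X]} (hp : IsUnit p) : unstableRootCount p = 0 := by
  obtain ⟨a, -, rfl⟩ := Polynomial.isUnit_iff.1 hp
  simp [unstableRootCount]

theorem unstableRootCount_eq_zero_iff {p : ℂ[X]} (hp : p ≠ 0) :
    unstableRootCount p = 0 ↔ ∀ z, Unstable z → ¬ p.IsRoot z := by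
  simp only [unstableRootCount, Multiset.countP_eq_zero, Polynomial.mem_roots hp]
  exact forall_congr' fun z => imp_not_comm

/-- Write `f = p / q`, not necessarily in lowest terms. The polynomial `p` is free of unstable roots if and only if `f` has no
unstable zeros and no unstable pole of `q` is lost by cancellation. -/
theorem forall_unstable_not_isRoot_iff {f : RatFunc ℂ} {p q : ℂ[X]} (hp : p ≠ 0) (hq : q ≠ 0)
    (hf : f = algebraMap ℂ[X] (RatFunc ℂ) p / algebraMap ℂ[X] (RatFunc ℂ) q) :
    (∀ z, Unstable z → ¬ p.IsRoot z) ↔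
      (∀ z, Unstable z → ¬ IsZero f z) ∧ unstablePoleCount f = unstableRootCount q := by
  have hmul := (RatFunc.num_mul_eq_mul_denom_iff hq).2 hf
  have hnum : f.num ≠ 0 := fun h =>
    mul_ne_zero hp f.denom_ne_zero (by rw [← hmul, h, zero_mul])
  have hadd : unstableRootCount f.num + unstableRootCount q
      = unstableRootCount p + unstablePoleCount f := by
    rw [unstablePoleCount, ← unstableRootCount_mul hnum hq,
      ← unstableRootCount_mul hp f.denom_ne_zero, hmul]
  -- With `hle`, the identity `hadd` makes the count of `p` the sum of two nonnegative quantities: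
  -- the count of zeros of `f` and the deficit of poles of `f` against roots of `q`.
  obtain ⟨g, hg⟩ : f.denom ∣ q := (RatFunc.denom_dvd hq).2 ⟨p, hf⟩
  have hle : unstablePoleCount f ≤ unstableRootCount q := by
    rw [hg, unstableRootCount_mul f.denom_ne_zero (right_ne_zero_of_mul (hg ▸ hq))]
    exact Nat.le_add_right _ _
  simp only [IsZero, ← unstableRootCount_eq_zero_iff hp, ← unstableRootCount_eq_zero_iff hnum]
  lia

/-! ### Stable rational matrices -/

section StableRing

/-- The rational functions without unstable poles form a ring. -/
noncomputable def stableSubring : Subring (RatFunc ℂ) where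
  carrier := {f | ∀ z, IsPole f z → z.re < 0}
  zero_mem' z hz := by simp [IsPole] at hz
  one_mem' z hz := by simp [IsPole] at hz
  add_mem' {f g} hf hg z hz := by
    have h := hz.dvd (RatFunc.denom_add_dvd f g)
    rw [Polynomial.root_mul] at h
    exact h.elim (hf z) (hg z)
  mul_mem' {f g} hf hg z hz := by
    have h := hz.dvd (RatFunc.denom_mul_dvd f g)
    rw [Polynomial.root_mul] at h
    exact h.elim (hf z) (hg z)
  neg_mem' {f} hf z hz := hf z (hz.dvd ((RatFunc.denom_dvd f.denom_ne_zero).2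
    ⟨-f.num, by rw [map_neg, neg_div, RatFunc.num_div_denom]⟩))

theorem algebraMap_mem_stableSubring (p : ℂ[X]) :
    algebraMap ℂ[X] (RatFunc ℂ) p ∈ stableSubring := fun z hz => by
  simp [IsPole] at hz

theorem inv_algebraMap_mem_stableSubring_iff {p : ℂ[X]} (hp : p ≠ 0) :
    (algebraMap ℂ[X] (RatFunc ℂ) p)⁻¹ ∈ stableSubring ↔ ∀ z, Unstable z → ¬ p.IsRoot z := by
  have h := RatFunc.associated_denom_inv (RatFunc.algebraMap_ne_zero (K := ℂ) hp)
  rw [RatFunc.num_algebraMap] at h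
  refine forall_congr' fun z => ?_
  rw [Unstable, ← not_lt, not_imp_not, IsPole]
  exact imp_congr ⟨fun hz => hz.dvd h.dvd, fun hz => hz.dvd h.symm.dvd⟩ Iff.rfl

variable {m : Type*} [Fintype m] [DecidableEq m]

theorem map_algebraMap_mem_matrix (T : Matrix m m ℂ[X]) :
    T.map (algebraMap ℂ[X] (RatFunc ℂ)) ∈ stableSubring.matrix :=
  fun _ _ => algebraMap_mem_stableSubring _

theorem det_mem_of_mem_matrix {S : Type*} [CommRing S] {R : Subring S} {A : Matrix m m S}
    (hA : A ∈ R.matrix) : A.det ∈ R := by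
  rw [det_apply]
  exact R.sum_mem fun σ _ => R.zsmul_mem (R.prod_mem fun i _ => hA _ _) _

/-- The inverse of a polynomial matrix is stable if and only if its determinant has no unstable
roots: the determinant of a stable inverse is stable, and conversely the inverse is the adjugate
divided by the determinant. -/
theorem inv_map_mem_matrix_iff {T : Matrix m m ℂ[X]} (hT : T.det ≠ 0) :
    (T.map (algebraMap ℂ[X] (RatFunc ℂ)))⁻¹ ∈ stableSubring.matrix ↔
      ∀ z, Unstable z → ¬ T.det.IsRoot z := by
  have hdet : (T.map (algebraMap ℂ[X] (RatFunc ℂ))).det = algebraMap ℂ[X] (RatFunc ℂ) T.det :=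
    ((algebraMap ℂ[X] (RatFunc ℂ)).map_det T).symm
  rw [← inv_algebraMap_mem_stableSubring_iff hT]
  constructor
  · intro h
    have h' := det_mem_of_mem_matrix h
    rwa [det_nonsing_inv, Ring.inverse_eq_inv', hdet] at h'
  · intro h i j
    have hadj : (T.map (algebraMap ℂ[X] (RatFunc ℂ))).adjugate
        = T.adjugate.map (algebraMap ℂ[X] (RatFunc ℂ)) :=
      ((algebraMap ℂ[X] (RatFunc ℂ)).map_adjugate T).symm
    rw [inv_def, Ring.inverse_eq_inv', hdet, hadj]
    exact stableSubring.mul_mem h (algebraMap_mem_stableSubring _)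

end StableRing

/-! ### Right coprime factorizations and the closed loop -/

/-- For a right coprime polynomial factorization `P = N M⁻¹`, the closed loop `N (M + N)⁻¹` is
stable if and only if `det (M + N)` has no unstable roots: by the Bézout identity
`X N + Y M = 1`, the inverse `(M + N)⁻¹ = X N (M + N)⁻¹ + Y (1 - N (M + N)⁻¹)` has no other
unstable poles than the closed loop. -/
theorem isStable_closedLoop_iff {n : ℕ} {P : Matrix (Fin n) (Fin n) (RatFunc ℂ)}
    {M N X Y : Matrix (Fin n) (Fin n) ℂ[X]} (hM : M.det ≠ 0)
    (hP : P * M.map (algebraMap ℂ[X] (RatFunc ℂ)) = N.map (algebraMap ℂ[X] (RatFunc ℂ)))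
    (hXY : X * N + Y * M = 1) (hT : (M + N).det ≠ 0) :
    IsStable (closedLoop P) ↔ ∀ z, Unstable z → ¬ (M + N).det.IsRoot z := by
  rw [← inv_map_mem_matrix_iff hT]
  set c := algebraMap ℂ[X] (RatFunc ℂ)
  have hunit {A : Matrix (Fin n) (Fin n) ℂ[X]} (hA : A.det ≠ 0) : IsUnit (A.map c).det := by
    rw [isUnit_iff_ne_zero, show (A.map c).det = c A.det from (c.map_det A).symm]
    exact RatFunc.algebraMap_ne_zero hA
  have hmap : (M + N).map c = M.map c + N.map c := Matrix.map_add c (map_add c) M N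
  have hfac : (1 + P) * M.map c = (M + N).map c := by
    rw [Matrix.add_mul, Matrix.one_mul, hP, hmap]
  have hinv : (1 + P)⁻¹ = M.map c * ((M + N).map c)⁻¹ := by
    rw [← hfac, Matrix.mul_inv_rev, ← Matrix.mul_assoc, mul_nonsing_inv _ (hunit hM),
      Matrix.one_mul]
  have hloop : closedLoop P = N.map c * ((M + N).map c)⁻¹ := by
    rw [closedLoop, hinv, ← Matrix.mul_assoc, hP]
  change closedLoop P ∈ stableSubring.matrix ↔ _
  constructor
  · intro h
    have hbez : X.map c * N.map c + Y.map c * M.map c = 1 := by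
      rw [← Matrix.map_mul, ← Matrix.map_mul, ← Matrix.map_add c (map_add c), hXY,
        Matrix.map_one c (map_zero c) (map_one c)]
    have hsum : M.map c * ((M + N).map c)⁻¹ = 1 - closedLoop P := by
      rw [hloop, eq_sub_iff_add_eq, ← Matrix.add_mul, ← hmap, mul_nonsing_inv _ (hunit hT)]
    have heq : ((M + N).map c)⁻¹ = X.map c * closedLoop P + Y.map c * (1 - closedLoop P) := by
      rw [← hsum, hloop, ← Matrix.mul_assoc, ← Matrix.mul_assoc, ← Matrix.add_mul, hbez,
        Matrix.one_mul]
    rw [heq]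
    exact add_mem (mul_mem (map_algebraMap_mem_matrix X) h)
      (mul_mem (map_algebraMap_mem_matrix Y) (sub_mem (one_mem _) h))
  · intro h
    rw [hloop]
    exact mul_mem (map_algebraMap_mem_matrix N) h

/-- A Smith–McMillan form `P = U diag (ε / ψ) V` gives the right coprime factorization `N M⁻¹` of
`P` with `N = U diag ε` and `M = V⁻¹ diag ψ`. -/
theorem IsSmithMcMillanForm.exists_coprime_factorization {n : ℕ}
    {P : Matrix (Fin n) (Fin n) (RatFunc ℂ)} {ε ψ : Fin n → ℂ[X]}
    (h : IsSmithMcMillanForm P ε ψ) :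
    ∃ (M N X Y : Matrix (Fin n) (Fin n) ℂ[X]) (u : ℂ[X]), IsUnit u ∧ M.det = u * ∏ i, ψ i ∧
      P * M.map (algebraMap ℂ[X] (RatFunc ℂ)) = N.map (algebraMap ℂ[X] (RatFunc ℂ)) ∧
      X * N + Y * M = 1 := by
  obtain ⟨U, V, hU, hV, hP⟩ := h.equiv
  choose a b hab using h.coprime
  refine ⟨V⁻¹ * diagonal ψ, U * diagonal ε, diagonal a * U⁻¹, diagonal b * V, V⁻¹.det,
    isUnit_nonsing_inv_det V hV, by rw [det_mul, det_diagonal], ?_, ?_⟩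
  · set c := algebraMap ℂ[X] (RatFunc ℂ)
    have hVV : V.map c * V⁻¹.map c = 1 := by
      rw [← Matrix.map_mul, mul_nonsing_inv _ hV, Matrix.map_one c (map_zero c) (map_one c)]
    rw [hP, Matrix.map_mul, Matrix.map_mul, Matrix.mul_assoc, ← Matrix.mul_assoc (V.map c), hVV,
      Matrix.one_mul, Matrix.mul_assoc, diagonal_map (map_zero c), diagonal_map (map_zero c),
      diagonal_mul_diagonal]
    congr 2
    ext1 i
    exact div_mul_cancel₀ _ (RatFunc.algebraMap_ne_zero (h.den_monic i).ne_zero)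
  · rw [Matrix.mul_assoc, ← Matrix.mul_assoc U⁻¹, nonsing_inv_mul _ hU, Matrix.one_mul,
      Matrix.mul_assoc, ← Matrix.mul_assoc V, mul_nonsing_inv _ hV, Matrix.one_mul,
      diagonal_mul_diagonal, diagonal_mul_diagonal, diagonal_add]
    simp [hab]

end Feedback

theorem theorem1 (n : ℕ) (P : Matrix (Fin n) (Fin n) (RatFunc ℂ))
    (hP : (1 + P).det ≠ 0) :
    (∃ ε ψ : Fin n → Polynomial ℂ, Feedback.IsSmithMcMillanForm P ε ψ) ∧
    ∀ ε ψ : Fin n → Polynomial ℂ, Feedback.IsSmithMcMillanForm P ε ψ →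
      (Feedback.IsStable (Feedback.closedLoop P) ↔
        (∀ z : ℂ, Feedback.Unstable z → ¬ Feedback.IsZero (1 + P).det z) ∧
        Feedback.unstablePoleCount (1 + P).det =
          ∑ i, Feedback.unstableRootCount (ψ i)) := by
  refine ⟨Feedback.exists_isSmithMcMillanForm P, fun ε ψ h => ?_⟩
  obtain ⟨M, N, X, Y, u, hu, hM, hPM, hXY⟩ := h.exists_coprime_factorization
  have hψ : ∀ i ∈ Finset.univ, ψ i ≠ 0 := fun i _ => (h.den_monic i).ne_zero
  have hprod : ∏ i, ψ i ≠ 0 := Finset.prod_ne_zero_iff.2 hψ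
  have hM0 : M.det ≠ 0 := hM ▸ mul_ne_zero hu.ne_zero hprod
  set c := algebraMap ℂ[X] (RatFunc ℂ)
  have hcM : c M.det ≠ 0 := RatFunc.algebraMap_ne_zero hM0
  have hdet : (1 + P).det * c M.det = c (M + N).det := by
    have hmul : (1 + P) * M.map c = (M + N).map c := by
      rw [Matrix.add_mul, Matrix.one_mul, hPM, Matrix.map_add c (map_add c)]
    rw [c.map_det, c.map_det]
    change _ * (M.map c).det = ((M + N).map c).det
    rw [← hmul, Matrix.det_mul]
  have hT : (M + N).det ≠ 0 := fun h0 => mul_ne_zero hP hcM (by rw [hdet, h0, map_zero])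
  have hcount : Feedback.unstableRootCount M.det = ∑ i, Feedback.unstableRootCount (ψ i) := by
    rw [hM, Feedback.unstableRootCount_mul hu.ne_zero hprod,
      Feedback.unstableRootCount_of_isUnit hu, zero_add, Feedback.unstableRootCount_prod _ _ hψ]
  rw [Feedback.isStable_closedLoop_iff hM0 hPM hXY hT, ← hcount]
  exact Feedback.forall_unstable_not_isRoot_iff hT hM0 (eq_div_of_mul_eq hcM hdet)
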